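/- For a positive integer $n$ let $\Phi_n(x)=\sum_{i=0}^{\varphi(n)}c_i x^i$ be the $n$-th cyclotomic polynomial and let $A(n)=\max\{|c_i| : 0\le i\le\varphi(n)\}$. For a prime $p$ let $M(p)=\max\{A(pqr) : q,r \text{ primes},\ p<q<r\}$. Then $M(7)=4$; that is, for all primes $7<q<r$ every coefficient of $\Phi_{7qr}$ has absolute value at most $4$, and for some primes $7<q<r$ some coefficient of $\Phi_{7qr}$ has absolute value exactly $4$. Hence, for $p=7$, both Beiter's conjecture ($A(pqr)\le\frac{p+1}{2}$ for all primes $p<q<r$, or in its reformulated version $M(p)=\frac{p+1}{2}$) and the Corrected Beiter conjecture ($M(p)\le\frac23 p$) hold. -/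

import Mathlib

/-- `A(n)`: the largest absolute value of a coefficient `c_i`, `0 ≤ i ≤ φ(n)`, of the
`n`-th cyclotomic polynomial. -/
noncomputable def cyclotomicHeight (n : ℕ) : ℕ :=
  (Finset.range (n.totient + 1)).sup fun i => ((Polynomial.cyclotomic n ℤ).coeff i).natAbs

/-- The set `{A(pqr) ∣ p < q < r}`, where `q` and `r` range over the primes. -/
def ternaryHeights (p : ℕ) : Set ℕ :=
  {a | ∃ q r : ℕ, q.Prime ∧ r.Prime ∧ p < q ∧ q < r ∧ a = cyclotomicHeight (p * q * r)}

/-- `M(p) = m`: the maximum of `{A(pqr) ∣ p < q < r}` exists and equals `m`. -/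
def MaxTernaryHeightEq (p m : ℕ) : Prop :=
  IsGreatest (ternaryHeights p) m

/-- Beiter's conjecture for `p`: `A(pqr) ≤ (p + 1) / 2` for all primes `p < q < r`. -/
def BeiterConjectureAt (p : ℕ) : Prop :=
  ∀ q r : ℕ, q.Prime → r.Prime → p < q → q < r →
    (cyclotomicHeight (p * q * r) : ℚ) ≤ ((p : ℚ) + 1) / 2

/-- Beiter's conjecture for `p` in its reformulated form: `M(p) = (p + 1) / 2`. -/
def BeiterConjectureMaxAt (p : ℕ) : Prop :=
  ∃ m : ℕ, MaxTernaryHeightEq p m ∧ (m : ℚ) = ((p : ℚ) + 1) / 2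

/-- The Corrected Beiter conjecture for `p`: `M(p) ≤ (2 / 3) p`. -/
def CorrectedBeiterConjectureAt (p : ℕ) : Prop :=
  ∃ m : ℕ, MaxTernaryHeightEq p m ∧ (m : ℚ) ≤ 2 / 3 * (p : ℚ)

/-!
Let `p`, `q`, `r` be distinct primes and let `I` be the indicator function of the numerical
semigroup generated by `q` and `r`. Then `Φ_{qr} = (1 - X) ∑ I(m) X^m`, and dividing
`Φ_{qr}(X^p)` by `Φ_{qr}` gives
`Φ_{pqr} (1 - X^{qr}) = (1 - X^q) (1 - X^r) ∑ I(⌊m / p⌋) X^m`.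
The `n`-th coefficient of `Φ_{pqr}` is therefore a sum of `4 p` terms `±I(⌊(n - s) / p⌋)`, where
`s = A q r + ε q + δ r` with `0 ≤ A < p` and `ε, δ ∈ {0, 1}`. Group them by the residue class `a`
of `s / (q r)` modulo `p`. The contribution of a class depends only on `q⁻¹` and `r⁻¹` modulo `p`,
on `k = ⌊n / qr⌋`, and on a cell, the rough position in `[0, q)` of `(p r)⁻¹ w` modulo `q`, where
`w ∈ (n - p, n]` is congruent to `s` modulo `p`. Replacing `r⁻¹` by `-r⁻¹` changes the sign of all
contributions, so an upper bound on the sums is enough.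

For `p = 7`, adding up the largest contribution of each class gives at most `4`, except when
`q⁻¹ = r⁻¹ = ±2` and `k ∈ {2, 3}`, where it gives at most `5`. When `a` increases by `(q r)⁻¹`,
`w` increases by `1`, apart from one jump; in the exceptional case the cells attaining the largest
contributions are incompatible with residues in arithmetic progression.
-/

open PowerSeries in
theorem coeff_X_pow_mul_mk_intCast {R : Type*} [Semiring R] {f : ℤ → R} (hf : ∀ m < 0, f m = 0)
    (d n : ℕ) : coeff n (X ^ d * mk fun m => f m) = f (n - d) := by
  rw [coeff_X_pow_mul']
  split_ifs with h
  · rw [coeff_mk, Nat.cast_sub h]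
  · rw [hf _ (by lia)]

/-- The indicator function of the numerical semigroup generated by `q` and `r`, for `r` invertible
modulo `q`: since `m * r⁻¹` is the least possible number of summands `r` in a representation of
`m`, only that number has to be tested. -/
def semigroupIndicator (q r : ℕ) (m : ℤ) : ℤ :=
  if (r * (m * (r : ZMod q)⁻¹ : ZMod q).val : ℤ) ≤ m then 1 else 0

/-- The generating function of the numerical semigroup generated by `q` and `r`. -/
noncomputable def semigroupSeries (q r : ℕ) : PowerSeries ℤ :=
  PowerSeries.mk fun m => semigroupIndicator q r m

/-- The series `∑ I(⌊m / p⌋) X^m`, where `I` is the indicator function of the numerical semigroup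
generated by `q` and `r`. -/
noncomputable def floorSeries (p q r : ℕ) : PowerSeries ℤ :=
  PowerSeries.mk fun m => semigroupIndicator q r ((m : ℤ) / p)

theorem semigroupIndicator_of_neg (q r : ℕ) {m : ℤ} (hm : m < 0) : semigroupIndicator q r m = 0 :=
  if_neg (hm.trans_le (mul_nonneg r.cast_nonneg (Nat.cast_nonneg _))).not_ge

section SemigroupSeries

variable {q r : ℕ} [Fact q.Prime]

theorem dvd_sub_mul_val (hr : (r : ZMod q) ≠ 0) (m : ℤ) :
    (q : ℤ) ∣ m - r * (m * (r : ZMod q)⁻¹ : ZMod q).val := by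
  rw [← ZMod.intCast_zmod_eq_zero_iff_dvd]
  push_cast
  rw [ZMod.natCast_zmod_val, mul_left_comm, mul_inv_cancel₀ hr, mul_one, sub_self]

theorem semigroupIndicator_sub (hr : (r : ZMod q) ≠ 0) (m : ℤ) :
    semigroupIndicator q r m - semigroupIndicator q r (m - q) =
      if m = r * (m * (r : ZMod q)⁻¹ : ZMod q).val then 1 else 0 := by
  have hshift : ((m - q : ℤ) : ZMod q) = m := by simp
  obtain ⟨t, ht⟩ := dvd_sub_mul_val hr m
  have hq : (0 : ℤ) < q := by exact_mod_cast (Fact.out : q.Prime).pos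
  simp only [semigroupIndicator, hshift]
  generalize (m * (r : ZMod q)⁻¹ : ZMod q).val = b at ht ⊢
  have h0 : (r * b : ℤ) ≤ m ↔ 0 ≤ t := by
    rw [← sub_nonneg, ht, mul_nonneg_iff_of_pos_left hq]
  have h1 : (r * b : ℤ) ≤ m - q ↔ 1 ≤ t := by
    rw [← sub_nonneg, show m - q - r * b = q * (t - 1) by linear_combination ht,
      mul_nonneg_iff_of_pos_left hq, sub_nonneg]
  have h2 : m = r * b ↔ t = 0 := by
    rw [← sub_eq_zero, ht, mul_eq_zero, or_iff_right hq.ne']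
  simp only [h0, h1, h2]
  split_ifs <;> lia

open PowerSeries in
theorem one_sub_X_pow_mul_semigroupSeries (hr : (r : ZMod q) ≠ 0) :
    (1 - X ^ q) * semigroupSeries q r = ∑ b ∈ Finset.range q, (X ^ r) ^ b := by
  ext m
  rw [sub_mul, one_mul, map_sub, semigroupSeries,
    coeff_X_pow_mul_mk_intCast (fun _ => semigroupIndicator_of_neg q r), coeff_mk,
    semigroupIndicator_sub hr, map_sum]
  have hunique : ∀ b ∈ Finset.range q,
      (m = r * b ↔ b = (m * (r : ZMod q)⁻¹ : ZMod q).val ∧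
        m = r * (m * (r : ZMod q)⁻¹ : ZMod q).val) := by
    intro b hb
    suffices m = r * b → (m * (r : ZMod q)⁻¹ : ZMod q).val = b by grind
    rintro rfl
    rw [Nat.cast_mul, mul_comm, inv_mul_cancel_left₀ hr,
      ZMod.val_cast_of_lt (Finset.mem_range.1 hb)]
  simp only [← pow_mul, coeff_X_pow]
  rw [Finset.sum_congr rfl fun b hb => if_congr (hunique b hb) rfl rfl]
  simp only [ite_and, Finset.sum_ite_eq', Finset.mem_range, ZMod.val_lt, if_true]
  norm_cast

end SemigroupSeries

open Polynomial in
theorem cyclotomic_mul_prime_mul {q r : ℕ} [hq : Fact q.Prime] [hr : Fact r.Prime] (hqr : q ≠ r) :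
    cyclotomic (q * r) ℤ * ((1 - X ^ q) * (1 - X ^ r)) = (1 - X ^ (q * r)) * (1 - X) := by
  have hcyc := cyclotomic_prime_mul_X_sub_one ℤ q
  have hexpand := congrArg (expand ℤ r) hcyc
  rw [map_mul, cyclotomic_expand_eq_cyclotomic_mul hr.out
    (fun h => hqr ((Nat.prime_dvd_prime_iff_eq hr.out hq.out).1 h).symm)] at hexpand
  simp only [map_sub, map_pow, expand_X, map_one, ← pow_mul'] at hexpand
  linear_combination (X - 1) * hexpand - cyclotomic (q * r) ℤ * (X ^ r - 1) * hcyc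

section Ternary

open PowerSeries

theorem one_sub_X_pow_ne_zero {R : Type*} [Ring R] [Nontrivial R] {d : ℕ} (hd : d ≠ 0) :
    (1 - X ^ d : PowerSeries R) ≠ 0 := fun h => by
  simpa [hd] using congrArg constantCoeff h

theorem one_sub_X_mul_mk_div {R : Type*} [CommRing R] {p : ℕ} (hp : p ≠ 0) (f : ℕ → R) :
    (1 - X) * mk (fun m => f (m / p)) = (1 - X ^ p) * expand p hp (mk f) := by
  ext m
  rw [sub_mul, sub_mul, one_mul, one_mul, map_sub, map_sub, coeff_X_pow_mul']
  simp only [coeff_expand, coeff_mk]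
  cases m with
  | zero => simp [hp]
  | succ m =>
    rw [coeff_succ_X_mul, coeff_mk]
    by_cases h : p ∣ m + 1
    · have hle := Nat.le_of_dvd m.succ_pos h
      have hdiv : (m + 1) / p = (m + 1 - p) / p + 1 :=
        Nat.div_eq_sub_div (Nat.pos_of_ne_zero hp) hle
      rw [if_pos h, if_pos hle, if_pos (Nat.dvd_sub h dvd_rfl), ← Nat.succ_inj.1
        ((Nat.succ_div_of_dvd h).symm.trans hdiv)]
    · rw [if_neg h, Nat.succ_div_of_not_dvd h, sub_self, zero_sub, eq_comm, neg_eq_zero]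
      refine ite_eq_right_iff.2 fun hle => if_neg fun h' => h ?_
      simpa [Nat.sub_add_cancel hle] using h'.add (dvd_refl p)

theorem coe_expand {R : Type*} [CommRing R] {p : ℕ} (hp : p ≠ 0) (f : Polynomial R) :
    (Polynomial.expand R p f : PowerSeries R) = expand p hp (f : PowerSeries R) := by
  ext m
  simp [Polynomial.coeff_expand (Nat.pos_of_ne_zero hp), coeff_expand]

variable {p q r : ℕ} [hp : Fact p.Prime] [hq : Fact q.Prime] [hr : Fact r.Prime]

theorem coe_cyclotomic_mul_prime_mul (hqr : q ≠ r) :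
    (Polynomial.cyclotomic (q * r) ℤ : PowerSeries ℤ) * ((1 - X ^ q) * (1 - X ^ r)) =
      (1 - X ^ (q * r)) * (1 - X) := by
  simpa using congrArg Polynomial.toPowerSeries (cyclotomic_mul_prime_mul hqr)

theorem coe_cyclotomic_mul_prime (hqr : q ≠ r) :
    (Polynomial.cyclotomic (q * r) ℤ : PowerSeries ℤ) = (1 - X) * semigroupSeries q r := by
  have hgeom := mul_neg_geom_sum (X ^ r : PowerSeries ℤ) q
  rw [← one_sub_X_pow_mul_semigroupSeries (ZMod.prime_ne_zero q r hqr), ← pow_mul'] at hgeom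
  refine mul_right_cancel₀ (mul_ne_zero (one_sub_X_pow_ne_zero hq.out.ne_zero)
    (one_sub_X_pow_ne_zero hr.out.ne_zero)) ?_
  linear_combination coe_cyclotomic_mul_prime_mul hqr - (1 - X) * hgeom

theorem coe_cyclotomic_ternary_mul_cyclotomic_mul (hpq : p ≠ q) (hpr : p ≠ r) (hqr : q ≠ r) :
    (Polynomial.cyclotomic (p * q * r) ℤ * Polynomial.cyclotomic (q * r) ℤ : PowerSeries ℤ) =
      (1 - X) * floorSeries p q r := by
  have hdvd : ¬ p ∣ q * r := by
    simp [hp.out.dvd_mul, Nat.prime_dvd_prime_iff_eq, hp.out, hq.out, hr.out, hpq, hpr]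
  have hfloor : (1 - X) * floorSeries p q r = _ :=
    one_sub_X_mul_mk_div hp.out.ne_zero fun m => semigroupIndicator q r m
  rw [hfloor, ← semigroupSeries, mul_assoc p q r, mul_comm p, ← Polynomial.coe_mul,
    ← Polynomial.cyclotomic_expand_eq_cyclotomic_mul hp.out hdvd, coe_expand hp.out.ne_zero,
    coe_cyclotomic_mul_prime hqr, map_mul, map_sub, map_one, expand_X]

theorem coe_cyclotomic_ternary_mul (hpq : p ≠ q) (hpr : p ≠ r) (hqr : q ≠ r) :
    (Polynomial.cyclotomic (p * q * r) ℤ : PowerSeries ℤ) * (1 - X ^ (q * r)) =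
      (1 - X ^ q) * (1 - X ^ r) * floorSeries p q r := by
  have hne : (1 - X : PowerSeries ℤ) ≠ 0 := by
    simpa using one_sub_X_pow_ne_zero (R := ℤ) one_ne_zero
  refine mul_left_cancel₀ hne ?_
  linear_combination
    (1 - X ^ q) * (1 - X ^ r) * coe_cyclotomic_ternary_mul_cyclotomic_mul hpq hpr hqr -
    (Polynomial.cyclotomic (p * q * r) ℤ : PowerSeries ℤ) * coe_cyclotomic_mul_prime_mul hqr

theorem coeff_cyclotomic_ternary (hpq : p ≠ q) (hpr : p ≠ r) (hqr : q ≠ r) {n : ℕ}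
    (hn : n < p * (q * r)) :
    (Polynomial.cyclotomic (p * q * r) ℤ).coeff n = ∑ A ∈ Finset.range p,
      (semigroupIndicator q r ((n - A * (q * r)) / p)
        - semigroupIndicator q r ((n - A * (q * r) - q) / p)
        - semigroupIndicator q r ((n - A * (q * r) - r) / p)
        + semigroupIndicator q r ((n - A * (q * r) - q - r) / p)) := by
  have hgeom := mul_neg_geom_sum (X ^ (q * r) : PowerSeries ℤ) p
  have hcyc : (Polynomial.cyclotomic (p * q * r) ℤ : PowerSeries ℤ) =
      X ^ (p * (q * r)) * (Polynomial.cyclotomic (p * q * r) ℤ : PowerSeries ℤ) +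
        ∑ A ∈ Finset.range p, (X ^ (A * (q * r)) * floorSeries p q r -
          X ^ (A * (q * r) + q) * floorSeries p q r - X ^ (A * (q * r) + r) * floorSeries p q r +
          X ^ (A * (q * r) + q + r) * floorSeries p q r) := by
    have hfactor (A : ℕ) : X ^ (A * (q * r)) * floorSeries p q r -
          X ^ (A * (q * r) + q) * floorSeries p q r - X ^ (A * (q * r) + r) * floorSeries p q r +
          X ^ (A * (q * r) + q + r) * floorSeries p q r =
        (X ^ (q * r)) ^ A * ((1 - X ^ q) * (1 - X ^ r) * floorSeries p q r) := by ring
    simp only [hfactor, ← Finset.sum_mul, ← coe_cyclotomic_ternary_mul hpq hpr hqr]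
    linear_combination -(Polynomial.cyclotomic (p * q * r) ℤ : PowerSeries ℤ) * hgeom
  have hneg : ∀ m < 0, semigroupIndicator q r (m / p) = 0 := fun m hm =>
    semigroupIndicator_of_neg q r (Int.ediv_neg_of_neg_of_pos hm (by exact_mod_cast hp.out.pos))
  rw [← Polynomial.coeff_coe, hcyc, map_add, coeff_X_pow_mul', if_neg hn.not_ge, zero_add, map_sum]
  refine Finset.sum_congr rfl fun A _ => ?_
  simp only [map_add, map_sub, floorSeries, coeff_X_pow_mul_mk_intCast hneg]
  push_cast
  simp only [sub_sub]

end Ternary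

/-- The position of a residue modulo `q`: the index of the interval `[i q / p, (i + 1) q / p)`
containing it, and whether it lies in an initial part of that interval singled out by a threshold
(see `cellOf`). -/
abbrev Cell (p : ℕ) : Type := ZMod p × Bool

/-- The value of the semigroup indicator at an argument located in the cell `x`, when `A` multiples
of `q r` have been subtracted and `k = ⌊n / qr⌋`. -/
def cellIndicator {p : ℕ} (k : ℕ) (A : ZMod p) (x : Cell p) : ℤ :=
  if x.1.val + A.val < k ∨ (x.1.val + A.val = k ∧ x.2) then 1 else 0

/-- The contribution to the `n`-th coefficient of `Φ_{pqr}` of the residue class `a` modulo `p`,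
where `u = q⁻¹`, `v = r⁻¹`, `k = ⌊n / qr⌋` and `x` is the cell of that class. The last two terms
come from the summand `-X^r` of `1 - X^r`, which moves the index of the cell by `u`. -/
def classContribution {p : ℕ} (u v : ZMod p) (k : ℕ) (a : ZMod p) (x : Cell p) : ℤ :=
  cellIndicator k a x - cellIndicator k (a - v) x
    - cellIndicator k (a - u) (x.1 + u, x.2) + cellIndicator k (a - u - v) (x.1 + u, x.2)

/-- A necessary condition for `x`, `y`, `z` to be the cells of three residues modulo `q` in
arithmetic progression. The three cases are those where the residues `y₁, y₂, y₃ ∈ [0, q)`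
in `cellOf` satisfy `y₁ + y₃ - 2 y₂ = q`, `-q` and `0`. -/
def IsCellProgression {p : ℕ} (x y z : Cell p) : Prop :=
  (x.1 + z.1 - 2 * y.1 = -1 ∧ (x.2 ∨ z.2 → y.2)) ∨
  (x.1 + z.1 - 2 * y.1 = 1 ∧ (y.2 → x.2 ∧ z.2)) ∨
  (x.1 + z.1 - 2 * y.1 = 0 ∧ (x.2 ∧ z.2 → y.2) ∧ (y.2 → x.2 ∨ z.2))

instance {p : ℕ} (x y z : Cell p) : Decidable (IsCellProgression x y z) := by
  unfold IsCellProgression; infer_instance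

/-- The cells `x a` form a progression in steps of `d`, except at the two classes next to the single
jump between `s` and `s + d`. -/
def IsCellProfile {p : ℕ} (d : ZMod p) (x : ZMod p → Cell p) : Prop :=
  ∃ s, ∀ a, a ≠ s → a ≠ s + d → IsCellProgression (x (a - d)) (x a) (x (a + d))

/-- The cell of the residue `z` modulo `q` with `p z = y`, where `y ≤ f` is the threshold: the index
`i` in `p z = i q + y` is determined by `i = -y q⁻¹` modulo `p`. -/
def cellOf (p f : ℕ) {q : ℕ} (y : ZMod q) : Cell p := (-(y.val * (q : ZMod p)⁻¹), y.val ≤ f)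

/-- The representative of the residue class `z` modulo `p` in the window `(n - p, n]`. -/
def windowRep (p : ℕ) (n : ℤ) (z : ZMod p) : ℤ := n - (n - z).val

/-- The cell of the residue class `a` modulo `p` in the formula for the `n`-th coefficient of
`Φ_{pqr}`. -/
def residueCell (p q r n : ℕ) (a : ZMod p) : Cell p :=
  cellOf p (n / r % q) (windowRep p n (a * (q * r)) * (r : ZMod q)⁻¹ : ZMod q)

theorem isCellProgression_cellOf {p q : ℕ} [Fact p.Prime] [NeZero q] (hq : (q : ZMod p) ≠ 0) (f : ℕ)
    {x y z : ZMod q} (h : x + z = 2 * y) :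
    IsCellProgression (cellOf p f x) (cellOf p f y) (cellOf p f z) := by
  obtain ⟨c, hc⟩ : (q : ℤ) ∣ x.val + z.val - 2 * y.val := by
    rw [← ZMod.intCast_zmod_eq_zero_iff_dvd]
    simp [h]
  have hcell : (cellOf p f x).1 + (cellOf p f z).1 - 2 * (cellOf p f y).1 = -c := by
    have hc' := congrArg (Int.cast : ℤ → ZMod p) hc
    push_cast at hc'
    simp only [cellOf]
    field_simp
    linear_combination -hc'
  have hx := x.val_lt
  have hy := y.val_lt
  have hz := z.val_lt
  have hq0 : (0 : ℤ) < q := by lia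
  have hlt : c < 2 := lt_of_mul_lt_mul_left (by lia) hq0.le
  have hgt : -2 < c := lt_of_mul_lt_mul_left (by lia) hq0.le
  simp only [IsCellProgression, hcell]
  simp only [cellOf, decide_eq_true_eq]
  obtain rfl | rfl | rfl : c = 1 ∨ c = -1 ∨ c = 0 := by lia
  · exact .inl ⟨by simp, by lia⟩
  · exact .inr (.inl ⟨by simp, by lia⟩)
  · exact .inr (.inr ⟨by simp, by lia, by lia⟩)

theorem windowRep_add_one {p : ℕ} [Fact p.Prime] {n : ℤ} {z : ZMod p} (hz : z ≠ n) :
    windowRep p n (z + 1) = windowRep p n z + 1 := by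
  have hval : (n - z : ZMod p).val ≠ 0 := by simpa [sub_eq_zero] using hz.symm
  rw [windowRep, windowRep, ← sub_sub, ZMod.val_sub (by rw [ZMod.val_one]; lia), ZMod.val_one]
  lia

theorem isCellProfile_residueCell {p q r : ℕ} [Fact p.Prime] [NeZero q] (hq : (q : ZMod p) ≠ 0)
    (hr : (r : ZMod p) ≠ 0) (n : ℕ) :
    IsCellProfile ((q : ZMod p)⁻¹ * (r : ZMod p)⁻¹) (residueCell p q r n) := by
  set d : ZMod p := (q : ZMod p)⁻¹ * (r : ZMod p)⁻¹ with hd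
  have hdqr : d * (q * r) = 1 := by rw [hd]; field_simp
  refine ⟨n * d, fun a ha ha' => ?_⟩
  have hnext : windowRep p n ((a + d) * (q * r)) = windowRep p n (a * (q * r)) + 1 := by
    rw [add_mul, hdqr, windowRep_add_one]
    intro h
    rw [Int.cast_natCast] at h
    exact ha (by linear_combination d * h - a * hdqr)
  have hprev : windowRep p n (a * (q * r)) = windowRep p n ((a - d) * (q * r)) + 1 := by
    rw [← windowRep_add_one, sub_mul, hdqr, sub_add_cancel]
    intro h
    rw [Int.cast_natCast] at h
    exact ha' (by linear_combination d * h - (a - d) * hdqr)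
  refine isCellProgression_cellOf hq _ ?_
  rw [hnext, hprev]
  push_cast
  ring

theorem mul_val_eq_cellOf {p q : ℕ} [Fact p.Prime] [Fact q.Prime] (hq : (q : ZMod p) ≠ 0) (f : ℕ)
    {y z : ZMod q} {δ : ℕ} (hδ : δ ≤ 1) (h : p * z = y - δ) :
    (p * z.val : ℤ) =
      ((cellOf p f y).1 + δ * (q : ZMod p)⁻¹).val * q + y.val - δ := by
  obtain ⟨c, hc⟩ : (q : ℤ) ∣ p * z.val - y.val + δ := by
    rw [← ZMod.intCast_zmod_eq_zero_iff_dvd]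
    simp [h]
  have hp := (Fact.out : p.Prime).two_le
  have hy := y.val_lt
  have hz := z.val_lt
  have hlt : c < p := lt_of_mul_lt_mul_left (a := (q : ℤ)) (by nlinarith) (by positivity)
  have hgt : -1 < c := lt_of_mul_lt_mul_left (a := (q : ℤ)) (by nlinarith) (by positivity)
  have hval : ((cellOf p f y).1 + δ * (q : ZMod p)⁻¹ : ZMod p) = (c.toNat : ZMod p) := by
    have hc' := congrArg (Int.cast : ℤ → ZMod p) hc
    rw [← Int.cast_natCast c.toNat, Int.toNat_of_nonneg (by lia)]
    push_cast [CharP.cast_eq_zero] at hc'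
    simp only [cellOf]
    field_simp
    linear_combination hc'
  rw [hval, ZMod.val_cast_of_lt (by lia), Int.toNat_of_nonneg (by lia)]
  linear_combination hc

theorem mul_add_le_iff {q e : ℕ} (he : e < q) (c N : ℕ) :
    c * q + e ≤ N ↔ c < N / q ∨ (c = N / q ∧ e ≤ N % q) := by
  have hN := Nat.div_add_mod' N q
  have hmod := Nat.mod_lt N (e.zero_le.trans_lt he)
  rcases lt_trichotomy c (N / q) with h | rfl | h
  · have hle := Nat.mul_le_mul_right q (Nat.succ_le_of_lt h)
    lia
  · lia
  · have hle := Nat.mul_le_mul_right q (Nat.succ_le_of_lt h)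
    lia

theorem mul_le_iff_mul_le_of_window {p q r b m j n A δ ε : ℤ} (hp : 1 < p) (hq : 1 < q)
    (hdvd : q ∣ m - r * b) (hm : p * m = j - A * (q * r) - ε * q - δ * r) (hε : 0 ≤ ε)
    (hε' : ε ≤ 1) (hj : n - p < j) (hjn : j ≤ n) :
    r * b ≤ m ↔ r * (p * b + A * q + δ) ≤ n := by
  have hgap : p * (m - r * b) = j - ε * q - r * (p * b + A * q + δ) := by linear_combination hm
  constructor
  · intro h
    have hnonneg : 0 ≤ p * (m - r * b) := mul_nonneg (by lia) (sub_nonneg.2 h)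
    have hεq : 0 ≤ ε * q := mul_nonneg hε (by lia)
    lia
  -- If `m < r b`, the gap is at least `q`, so that `p q` outweighs both the window and `ε q`.
  · contrapose!
    intro h
    obtain ⟨t, ht⟩ := hdvd
    have ht1 : t ≤ -1 := by
      by_contra! ht0
      nlinarith
    have hjump : m - r * b ≤ -q := by nlinarith
    have hpq : p * (m - r * b) ≤ p * -q := mul_le_mul_of_nonneg_left hjump (by lia)
    rw [hgap] at hpq
    nlinarith [mul_pos (sub_pos.2 hp) (sub_pos.2 hq)]

theorem windowRep_intCast {p : ℕ} [NeZero p] (n y : ℤ) :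
    windowRep p n (n - y : ℤ) = n - y % p := by
  rw [windowRep, ← ZMod.val_intCast]
  push_cast
  rw [sub_sub_cancel]

theorem semigroupIndicator_eq_cellIndicator {p q r : ℕ} [hp : Fact p.Prime] [hq : Fact q.Prime]
    (hqp : (q : ZMod p) ≠ 0) (hrp : (r : ZMod p) ≠ 0) (hrq : (r : ZMod q) ≠ 0)
    (n : ℕ) (A : ZMod p) {δ ε : ℕ} (hδ : δ ≤ 1) (hε : ε ≤ 1) {a : ZMod p}
    (ha : a = A + ε * (r : ZMod p)⁻¹ + δ * (q : ZMod p)⁻¹) :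
    semigroupIndicator q r ((n - A.val * (q * r) - ε * q - δ * r) / p) =
      cellIndicator (n / r / q) A
        ((residueCell p q r n a).1 + δ * (q : ZMod p)⁻¹, (residueCell p q r n a).2) := by
  have hr : 0 < r := Nat.pos_of_ne_zero fun h => hrq (by simp [h])
  set s : ℤ := n - A.val * (q * r) - ε * q - δ * r with hs
  set m : ℤ := s / p
  set y : ZMod q := windowRep p n (a * (q * r)) * (r : ZMod q)⁻¹ with hy
  set z : ZMod q := m * (r : ZMod q)⁻¹ with hz
  have hwindow : windowRep p n (a * (q * r)) = n - s % p := by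
    rw [← windowRep_intCast, hs, ha]
    congr 1
    push_cast
    rw [ZMod.natCast_zmod_val]
    field_simp
    ring
  have hm : p * m = (n - s % p) - A.val * (q * r) - ε * q - δ * r := by
    linear_combination Int.mul_ediv_add_emod s p + hs
  have hzy : p * z = y - δ := by
    have hm' := congrArg (Int.cast : ℤ → ZMod q) hm
    push_cast [CharP.cast_eq_zero] at hm'
    rw [hy, hz, hwindow]
    push_cast
    field_simp
    linear_combination hm'
  have hp0 : (0 : ℤ) < p := by exact_mod_cast hp.out.pos
  have hcell : (r * z.val : ℤ) ≤ m ↔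
      (((residueCell p q r n a).1 + δ * (q : ZMod p)⁻¹).val + A.val) * q + y.val ≤ n / r := by
    rw [mul_le_iff_mul_le_of_window (n := n) (j := n - s % p) (by exact_mod_cast hp.out.one_lt)
      (by exact_mod_cast hq.out.one_lt) (dvd_sub_mul_val hrq m) hm (by positivity)
      (by exact_mod_cast hε) (by linarith [Int.emod_lt_of_pos s hp0])
      (by linarith [Int.emod_nonneg s hp0.ne']),
      mul_val_eq_cellOf hqp (n / r % q) hδ hzy, Nat.le_div_iff_mul_le hr, residueCell, ← hy]
    zify
    ring_nf
  simp only [semigroupIndicator, cellIndicator, ← hz, hcell, mul_add_le_iff y.val_lt]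
  simp only [residueCell, cellOf, ← hy, decide_eq_true_eq]

theorem sum_range_eq_sum_zmod_val {M : Type*} [AddCommMonoid M] (p : ℕ) [NeZero p] (f : ℕ → M) :
    ∑ A ∈ Finset.range p, f A = ∑ A : ZMod p, f A.val := by
  refine Finset.sum_nbij' (fun A => (A : ZMod p)) ZMod.val ?_ ?_ ?_ ?_ ?_ <;>
    simp +contextual [ZMod.val_lt, Nat.mod_eq_of_lt]

theorem sum_cellIndicator_eq_sum_classContribution {p : ℕ} [NeZero p] (u v : ZMod p) (k : ℕ)
    (x : ZMod p → Cell p) :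
    ∑ A : ZMod p, (cellIndicator k A (x A) - cellIndicator k A (x (A + v))
      - cellIndicator k A ((x (A + u)).1 + u, (x (A + u)).2)
      + cellIndicator k A ((x (A + v + u)).1 + u, (x (A + v + u)).2)) =
    ∑ a, classContribution u v k a (x a) := by
  have hv := Equiv.sum_comp (Equiv.addRight v) fun a => cellIndicator k (a - v) (x a)
  have hu := Equiv.sum_comp (Equiv.addRight u) fun a =>
    cellIndicator k (a - u) ((x a).1 + u, (x a).2)
  have huv := Equiv.sum_comp (Equiv.addRight (v + u)) fun a =>
    cellIndicator k (a - u - v) ((x a).1 + u, (x a).2)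
  simp only [Equiv.coe_addRight, ← add_assoc, add_sub_cancel_right] at hu hv huv
  simp only [classContribution, Finset.sum_add_distrib, Finset.sum_sub_distrib, hu, hv, huv]

theorem coeff_cyclotomic_ternary_eq_sum_classContribution {p q r n : ℕ} [Fact p.Prime]
    [Fact q.Prime] [Fact r.Prime] (hpq : p ≠ q) (hpr : p ≠ r) (hqr : q ≠ r) (hn : n < p * (q * r)) :
    (Polynomial.cyclotomic (p * q * r) ℤ).coeff n = ∑ a : ZMod p,
      classContribution (q : ZMod p)⁻¹ (r : ZMod p)⁻¹ (n / r / q) a (residueCell p q r n a) := by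
  have hcell (A : ZMod p) {δ ε : ℕ} (hδ : δ ≤ 1) (hε : ε ≤ 1) :=
    semigroupIndicator_eq_cellIndicator (ZMod.prime_ne_zero p q hpq) (ZMod.prime_ne_zero p r hpr)
      (ZMod.prime_ne_zero q r hqr) n A hδ hε rfl
  have h₀₀ (A : ZMod p) := hcell A zero_le_one zero_le_one
  have h₀₁ (A : ZMod p) := hcell A zero_le_one le_rfl
  have h₁₀ (A : ZMod p) := hcell A le_rfl zero_le_one
  have h₁₁ (A : ZMod p) := hcell A le_rfl le_rfl
  push_cast at h₀₀ h₀₁ h₁₀ h₁₁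
  simp only [zero_mul, one_mul, add_zero, sub_zero] at h₀₀ h₀₁ h₁₀ h₁₁
  rw [coeff_cyclotomic_ternary hpq hpr hqr hn, sum_range_eq_sum_zmod_val]
  simp only [h₀₀, h₀₁, h₁₀, h₁₁]
  exact sum_cellIndicator_eq_sum_classContribution _ _ _ _

theorem classContribution_neg_right {p : ℕ} (u v : ZMod p) (k : ℕ) (a : ZMod p) (x : Cell p) :
    classContribution u (-v) k a x = -classContribution u v k (a + v) x := by
  simp only [classContribution, sub_neg_eq_add, add_sub_cancel_right, add_sub_right_comm a v u]
  ring

theorem IsCellProgression.symm {p : ℕ} {x y z : Cell p} (h : IsCellProgression x y z) :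
    IsCellProgression z y x := by
  rw [IsCellProgression] at h ⊢
  rwa [add_comm z.1, or_comm (a := (z.2 : Prop)), and_comm (a := (z.2 : Prop))]

theorem IsCellProfile.neg {p : ℕ} {d : ZMod p} {x : ZMod p → Cell p} (h : IsCellProfile d x) :
    IsCellProfile (-d) x := by
  obtain ⟨s, hs⟩ := h
  refine ⟨s + d, fun a ha ha' => ?_⟩
  rw [sub_neg_eq_add, ← sub_eq_add_neg]
  exact (hs a (by simpa using ha') ha).symm

theorem IsCellProfile.comp_add_right {p : ℕ} {d : ZMod p} {x : ZMod p → Cell p}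
    (h : IsCellProfile d x) (t : ZMod p) : IsCellProfile d fun a => x (a + t) := by
  obtain ⟨s, hs⟩ := h
  refine ⟨s - t, fun a ha ha' => ?_⟩
  have hprog := hs (a + t) (by rwa [ne_eq, ← eq_sub_iff_add_eq])
    (by rwa [ne_eq, ← eq_sub_iff_add_eq, add_sub_right_comm])
  rwa [add_sub_right_comm, add_right_comm] at hprog

/-- The largest contribution of the residue class `a` over all cells. -/
def maxContribution {p : ℕ} [NeZero p] (u v : ZMod p) (k : ℕ) (a : ZMod p) : ℤ :=
  Finset.univ.sup' Finset.univ_nonempty (classContribution u v k a)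

theorem classContribution_le_maxContribution {p : ℕ} [NeZero p] (u v : ZMod p) (k : ℕ)
    (a : ZMod p) (x : Cell p) : classContribution u v k a x ≤ maxContribution u v k a :=
  Finset.le_sup' _ (Finset.mem_univ x)

section FiniteChecks

set_option maxRecDepth 10000

theorem sum_maxContribution_le_four (u v : ZMod 7) {k : ℕ} (hk : k < 6)
    (h : ¬ (u = v ∧ u * u = 4 ∧ k ∈ Finset.Icc 2 3)) : ∑ a, maxContribution u v k a ≤ 4 := by
  revert u v k
  decide +kernel

theorem sum_maxContribution_le_five {u : ZMod 7} (hu : u * u = 4) {k : ℕ}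
    (hk : k ∈ Finset.Icc 2 3) : ∑ a, maxContribution u u k a ≤ 5 := by
  revert u k
  decide +kernel

theorem not_isCellProgression_of_eq_maxContribution {u : ZMod 7} (hu : u * u = 4) {k : ℕ}
    (hk : k ∈ Finset.Icc 2 3) {a : ZMod 7} (ha : a ∈ ({u - 1, u} : Finset (ZMod 7)))
    {x y z : Cell 7} (hx : classContribution u u k (a - 4) x = maxContribution u u k (a - 4))
    (hy : classContribution u u k a y = maxContribution u u k a)
    (hz : classContribution u u k (a + 4) z = maxContribution u u k (a + 4)) :
    ¬ IsCellProgression x y z := by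
  revert u k a x y z
  decide +kernel

end FiniteChecks

theorem sum_classContribution_le_four_of_mul_self_eq_four {u : ZMod 7} (hu : u * u = 4) {k : ℕ}
    (hk : k ∈ Finset.Icc 2 3) {x : ZMod 7 → Cell 7} (hx : IsCellProfile 4 x) :
    ∑ a, classContribution u u k a (x a) ≤ 4 := by
  obtain ⟨s, hs⟩ := hx
  have hle (a : ZMod 7) (_ : a ∈ Finset.univ) :=
    classContribution_le_maxContribution u u k a (x a)
  by_contra! hsum
  have hmax := (Finset.sum_eq_sum_iff_of_le hle).1
    (le_antisymm (Finset.sum_le_sum hle) ((sum_maxContribution_le_five hu hk).trans hsum))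
  -- The exceptional classes differ by `4`, so they cannot be both `u - 1` and `u`.
  obtain ⟨a, ha, has, has'⟩ : ∃ a ∈ ({u - 1, u} : Finset (ZMod 7)), a ≠ s ∧ a ≠ s + 4 := by
    clear * -
    decide +revert
  exact not_isCellProgression_of_eq_maxContribution hu hk ha (hmax _ (Finset.mem_univ _))
    (hmax _ (Finset.mem_univ _)) (hmax _ (Finset.mem_univ _)) (hs a has has')

theorem sum_classContribution_le_four (u v : ZMod 7) {k : ℕ} (hk : k < 6) {x : ZMod 7 → Cell 7}
    (hx : IsCellProfile (u * v) x) : ∑ a, classContribution u v k a (x a) ≤ 4 := by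
  by_cases h : u = v ∧ u * u = 4 ∧ k ∈ Finset.Icc 2 3
  · obtain ⟨rfl, hu, hk'⟩ := h
    exact sum_classContribution_le_four_of_mul_self_eq_four hu hk' (hu ▸ hx)
  · exact (Finset.sum_le_sum fun a _ => classContribution_le_maxContribution u v k a (x a)).trans
      (sum_maxContribution_le_four u v hk h)

theorem abs_sum_classContribution_le_four (u v : ZMod 7) {k : ℕ} (hk : k < 6)
    {x : ZMod 7 → Cell 7} (hx : IsCellProfile (u * v) x) :
    |∑ a, classContribution u v k a (x a)| ≤ 4 := by
  have hneg : -∑ a, classContribution u v k a (x a) =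
      ∑ a, classContribution u (-v) k a (x (a + v)) := by
    rw [← Finset.sum_neg_distrib, ← Equiv.sum_comp (Equiv.addRight v)]
    simp only [classContribution_neg_right, Equiv.coe_addRight]
  refine abs_le'.2 ⟨sum_classContribution_le_four u v hk hx, ?_⟩
  rw [hneg]
  refine sum_classContribution_le_four u (-v) hk ?_
  rw [mul_neg]
  exact hx.neg.comp_add_right v

theorem cyclotomicHeight_seven_mul_mul_le_four {q r : ℕ} (hq : q.Prime) (hr : r.Prime)
    (h7q : 7 ≠ q) (h7r : 7 ≠ r) (hqr : q ≠ r) : cyclotomicHeight (7 * q * r) ≤ 4 := by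
  have : Fact (Nat.Prime 7) := ⟨by norm_num⟩
  have : Fact q.Prime := ⟨hq⟩
  have : Fact r.Prime := ⟨hr⟩
  refine Finset.sup_le fun i hi => ?_
  have hlt : i < 6 * (q * r) := by
    have h7 : (7 : ℕ).Coprime (q * r) :=
      .mul_right ((Nat.coprime_primes Fact.out hq).2 h7q) ((Nat.coprime_primes Fact.out hr).2 h7r)
    have htot : (q * r).totient < q * r := Nat.totient_lt _ (by nlinarith [hq.two_le, hr.two_le])
    rw [mul_assoc, Nat.totient_mul h7, Nat.totient_prime Fact.out, Finset.mem_range] at hi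
    lia
  have hk : i / r / q < 6 := by
    rwa [Nat.div_lt_iff_lt_mul hq.pos, Nat.div_lt_iff_lt_mul hr.pos, mul_assoc]
  have hq' := ZMod.prime_ne_zero 7 q h7q
  have hr' := ZMod.prime_ne_zero 7 r h7r
  zify
  rw [coeff_cyclotomic_ternary_eq_sum_classContribution h7q h7r hqr (by lia)]
  exact abs_sum_classContribution_le_four _ _ hk (isCellProfile_residueCell hq' hr' i)

theorem coeff_cyclotomic_seven_mul_seventeen_mul_twentythree :
    (Polynomial.cyclotomic (7 * 17 * 23) ℤ).coeff 875 = 4 := by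
  rw [coeff_cyclotomic_ternary (p := 7) (q := 17) (r := 23) (hp := ⟨by norm_num⟩)
    (hq := ⟨by norm_num⟩) (hr := ⟨by norm_num⟩) (by norm_num) (by norm_num) (by norm_num)
    (by norm_num)]
  decide +kernel

theorem natAbs_coeff_cyclotomic_le_cyclotomicHeight (n i : ℕ) :
    ((Polynomial.cyclotomic n ℤ).coeff i).natAbs ≤ cyclotomicHeight n := by
  rcases lt_or_ge n.totient i with h | h
  · simp [Polynomial.coeff_eq_zero_of_natDegree_lt, Polynomial.natDegree_cyclotomic, h]
  · exact Finset.le_sup (f := fun j => ((Polynomial.cyclotomic n ℤ).coeff j).natAbs)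
      (Finset.mem_range_succ_iff.2 h)

theorem maxTernaryHeightEq_seven_four : MaxTernaryHeightEq 7 4 := by
  refine ⟨⟨17, 23, by norm_num, by norm_num, by norm_num, by norm_num, le_antisymm ?_ ?_⟩, ?_⟩
  · have hle := natAbs_coeff_cyclotomic_le_cyclotomicHeight (7 * 17 * 23) 875
    rwa [coeff_cyclotomic_seven_mul_seventeen_mul_twentythree] at hle
  · exact cyclotomicHeight_seven_mul_mul_le_four (by norm_num) (by norm_num) (by norm_num)
      (by norm_num) (by norm_num)
  · rintro _ ⟨q, r, hq, hr, hq7, hqr, rfl⟩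
    exact cyclotomicHeight_seven_mul_mul_le_four hq hr hq7.ne (hq7.trans hqr).ne hqr.ne

theorem theorem3p5 :
    MaxTernaryHeightEq 7 4 ∧
      BeiterConjectureAt 7 ∧ BeiterConjectureMaxAt 7 ∧ CorrectedBeiterConjectureAt 7 := by
  have hmax := maxTernaryHeightEq_seven_four
  refine ⟨hmax, fun q r hq hr hq7 hqr => ?_, ⟨4, hmax, by norm_num⟩, ⟨4, hmax, by norm_num⟩⟩
  have hle : (cyclotomicHeight (7 * q * r) : ℚ) ≤ 4 := by
    exact_mod_cast hmax.2 ⟨q, r, hq, hr, hq7, hqr, rfl⟩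
  exact hle.trans (by norm_num)
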